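/- **Theorem 1.5 (generalized Beraha–Kahane–Weiss theorem).** Let $D \subset \mathbb{C}$ be a domain (a nonempty connected open set), let $m \ge 2$, and let $\alpha_1,\dots,\alpha_m,\beta_1,\dots,\beta_m$ be analytic functions on $D$, none of which is identically zero. Call an index $k$ *dominant at* $z \in D$ if $|\beta_k(z)| \ge |\beta_l(z)|$ for all $1 \le l \le m$, and let $D_k = \{z \in D : k \text{ is dominant at } z\}$. Assume the "no-degenerate-dominance" condition: there do not exist indices $k \ne k'$ such that $\beta_k \equiv \omega\beta_{k'}$ on $D$ for some constant $\omega$ with $|\omega| = 1$ and such that $D_k$ ($= D_{k'}$) has nonempty interior. For each integer $n \ge 0$ define $$f_n(z) = \sum_{k=1}^m \alpha_k(z)\,\beta_k(z)^n, \qquad \mathcal{Z}(f_n) = \{z \in D : f_n(z) = 0\}.$$ Let $\liminf \mathcal{Z}(f_n)$ (respectively $\limsup \mathcal{Z}(f_n)$) be the set of all $z \in D$ such that every neighborhood $U$ of $z$ satisfies $U \cap \mathcal{Z}(f_n) \neq \emptyset$ for all but finitely many $n$ (respectively for infinitely many $n$). Then $\liminf \mathcal{Z}(f_n) = \limsup \mathcal{Z}(f_n)$,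 and a point $z \in D$ lies in this set if and only if either (a) there is a unique dominant index $k$ at $z$, and $\alpha_k(z) = 0$; or (b) there are two or more dominant indices at $z$. -/

import Mathlib

open Filter Topology

namespace BKW

/-- The zero set in `D` of a function `f`. -/
def zeroSet (D : Set ℂ) (f : ℂ → ℂ) : Set ℂ :=
  {z ∈ D | f z = 0}

/-- The points of `D` all of whose neighborhoods meet all but finitely many of the sets `Z n`. -/
def liminfSets (D : Set ℂ) (Z : ℕ → Set ℂ) : Set ℂ :=
  {z ∈ D | ∀ U ∈ 𝓝 z, ∀ᶠ n in atTop, (U ∩ Z n).Nonempty}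

/-- The points of `D` all of whose neighborhoods meet infinitely many of the sets `Z n`
(that is, `Z n` for infinitely many `n`). -/
def limsupSets (D : Set ℂ) (Z : ℕ → Set ℂ) : Set ℂ :=
  {z ∈ D | ∀ U ∈ 𝓝 z, ∃ᶠ n in atTop, (U ∩ Z n).Nonempty}

/-- The index `k` is dominant at `z`: `|β_k(z)| ≥ |β_l(z)|` for all `l`. -/
def IsDominant {m : ℕ} (β : Fin m → ℂ → ℂ) (k : Fin m) (z : ℂ) : Prop :=
  ∀ l : Fin m, ‖β l z‖ ≤ ‖β k z‖

/-- The set `D_k` of points of `D` at which the index `k` is dominant. -/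
def dominanceSet {m : ℕ} (D : Set ℂ) (β : Fin m → ℂ → ℂ) (k : Fin m) : Set ℂ :=
  {z ∈ D | IsDominant β k z}

/-- There are no indices `k ≠ k'` such that `β_k ≡ ω β_{k'}` on `D` for a constant `ω` with
`|ω| = 1` and such that `D_k` has nonempty interior. -/
def NoDegenerateDominance {m : ℕ} (D : Set ℂ) (β : Fin m → ℂ → ℂ) : Prop :=
  ¬ ∃ k k' : Fin m, k ≠ k' ∧
    (∃ ω : ℂ, ‖ω‖ = 1 ∧ ∀ z ∈ D, β k z = ω * β k' z) ∧
    (interior (dominanceSet D β k)).Nonempty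

/-- The function `f_n = ∑ k, α_k β_k ^ n`. -/
noncomputable def fSeq {m : ℕ} (α β : Fin m → ℂ → ℂ) (n : ℕ) (z : ℂ) : ℂ :=
  ∑ k : Fin m, α k z * β k z ^ n

end BKW

/-! A point with a strictly dominant index `k` is easy: there `f_n / β_k ^ n → α_k` locally
uniformly, so Hurwitz's theorem decides whether zeros accumulate. Near a point with several
dominant indices there are points `p`, `q` at which different indices `k`, `k'` are strictly
dominant, with nonzero coefficients. If `f_n` had no zeros on a disc containing `p` and `q`, then
`u_n = log |f_n / β_k ^ n|` would be harmonic there, at most linear in `n` on the disc and bounded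
near `p`. Borel-Carathéodory and the three circles theorem then interpolate to give
`u_n(q) = O(n ^ t)` with `t < 1`, whereas `u_n(q)` grows like `n log |β_k' / β_k|(q)`. -/

namespace BKW

open Metric Complex.HadamardThreeLines

section ThreeCircles

theorem closure_verticalStrip {a b : ℝ} (hab : a ≠ b) :
    closure (verticalStrip a b) = verticalClosedStrip a b := by
  rw [verticalStrip, Complex.closure_preimage_re, closure_Ioo hab]
  rfl

theorem dist_add_exp_self (c w : ℂ) : dist (c + Complex.exp w) c = Real.exp w.re := by
  rw [dist_eq_norm, add_sub_cancel_left, Complex.norm_exp]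

theorem mapsTo_add_exp_verticalClosedStrip {s S : ℝ} (c : ℂ) (hs : 0 < s) (hS : 0 < S) :
    Set.MapsTo (fun w => c + Complex.exp w) (verticalClosedStrip (Real.log s) (Real.log S))
      (closedBall c S \ ball c s) := by
  rintro w ⟨hw₁, hw₂⟩
  refine ⟨?_, ?_⟩
  · rw [mem_closedBall, dist_add_exp_self]
    exact (Real.le_log_iff_exp_le hS).mp hw₂
  · rw [mem_ball, dist_add_exp_self, not_lt]
    exact (Real.log_le_iff_le_exp hs).mp hw₁

/-- **Hadamard's three circles theorem**, deduced from the three lines theorem for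
`w ↦ f (c + exp w)`. -/
theorem norm_le_interp_of_mem_annulus {E : Type*} [NormedAddCommGroup E] [NormedSpace ℂ E]
    {f : ℂ → E} {c q : ℂ} {s S a b : ℝ} (hs : 0 < s) (hsS : s < S)
    (hf : DifferentiableOn ℂ f (closedBall c S \ ball c s)) (hq : q ∈ closedBall c S \ ball c s)
    (ha : ∀ z ∈ sphere c s, ‖f z‖ ≤ a) (hb : ∀ z ∈ sphere c S, ‖f z‖ ≤ b) :
    ‖f q‖ ≤ a ^ (1 - (Real.log (dist q c) - Real.log s) / (Real.log S - Real.log s)) *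
      b ^ ((Real.log (dist q c) - Real.log s) / (Real.log S - Real.log s)) := by
  have hS : 0 < S := hs.trans hsS
  have hlog : Real.log s < Real.log S := Real.log_lt_log hs hsS
  have hmaps := mapsTo_add_exp_verticalClosedStrip c hs hS
  have hdiff : DiffContOnCl ℂ (fun w => f (c + Complex.exp w))
      (verticalStrip (Real.log s) (Real.log S)) := by
    refine DifferentiableOn.diffContOnCl ?_
    rw [closure_verticalStrip hlog.ne]
    exact hf.comp (by fun_prop) hmaps
  have hbdd : BddAbove ((norm ∘ fun w => f (c + Complex.exp w)) ''
      verticalClosedStrip (Real.log s) (Real.log S)) := by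
    obtain ⟨C, hC⟩ := ((isCompact_closedBall c S).diff isOpen_ball).exists_bound_of_continuousOn
      hf.continuousOn
    exact ⟨C, Set.forall_mem_image.mpr fun w hw => hC _ (hmaps hw)⟩
  have hq₀ : 0 < dist q c := hs.trans_le (not_lt.mp hq.2)
  have hre : (Complex.log (q - c)).re = Real.log (dist q c) := by
    rw [Complex.log_re, dist_eq_norm]
  have hmem : Complex.log (q - c) ∈ verticalClosedStrip (Real.log s) (Real.log S) := by
    rw [verticalClosedStrip, Set.mem_preimage, hre]
    exact ⟨Real.log_le_log hs (not_lt.mp hq.2), Real.log_le_log hq₀ hq.1⟩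
  have hinterp := norm_le_interp_of_mem_verticalClosedStrip' hlog hmem hdiff hbdd
    (fun w hw => ha _ ?_) (fun w hw => hb _ ?_)
  · simpa only [hre, Complex.exp_log (sub_ne_zero.mpr (dist_pos.mp hq₀)), add_sub_cancel]
      using hinterp
  · rw [mem_sphere, dist_add_exp_self, Set.mem_singleton_iff.mp hw, Real.exp_log hs]
  · rw [mem_sphere, dist_add_exp_self, Set.mem_singleton_iff.mp hw, Real.exp_log hS]

end ThreeCircles

theorem norm_le_of_re_le_of_mem_sphere {F : ℂ → ℂ} {c : ℂ} {R M ρ : ℝ} (hM : 0 < M)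
    (hF : DifferentiableOn ℂ F (ball c R)) (hre : ∀ z ∈ ball c R, (F z).re ≤ M)
    (hρ : ρ < R) {z : ℂ} (hz : z ∈ sphere c ρ) :
    ‖F z‖ ≤ 2 * M * ρ / (R - ρ) + ‖F c‖ * (R + ρ) / (R - ρ) := by
  have hmaps : Set.MapsTo (fun w => c + w) (ball 0 R) (ball c R) := fun w hw => by
    simpa using hw
  have hnorm : ‖z - c‖ = ρ := mem_sphere_iff_norm.mp hz
  have hbound := Complex.borelCaratheodory (f := fun w => F (c + w)) (z := z - c) hM
    (hF.comp (by fun_prop) hmaps) (fun w hw => hre _ (hmaps hw))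
    ((hnorm ▸ norm_nonneg (z - c) : 0 ≤ ρ).trans_lt hρ)
    (by rwa [mem_ball_zero_iff, hnorm])
  simpa only [hnorm, add_sub_cancel, add_zero] using hbound

theorem exists_analyticOnNhd_re_eq_of_harmonicOnNhd {u : ℂ → ℝ} {c : ℂ} {R : ℝ}
    (hu : InnerProductSpace.HarmonicOnNhd u (ball c R)) :
    ∃ F : ℂ → ℂ, AnalyticOnNhd ℂ F (ball c R) ∧ (∀ z ∈ ball c R, (F z).re = u z) ∧
      (F c).im = 0 := by
  obtain ⟨F, hF, hFu⟩ := hu.exists_analyticOnNhd_ball_re_eq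
  exact ⟨fun z => F z - (F c).im * Complex.I, hF.sub analyticOnNhd_const,
    fun z hz => by simpa using hFu hz, by simp⟩

/-- The interpolation at the heart of the proof: a large upper bound `M` on a disc costs only
a factor `M ^ t` with `t < 1` at a given point, once there is a fixed bound near the centre. -/
theorem exists_forall_norm_le_mul_rpow {c q : ℂ} {r R B : ℝ} (hr : 0 < r) (hrq : r ≤ dist q c)
    (hq : q ∈ ball c R) :
    ∃ A t : ℝ, t < 1 ∧ ∀ M : ℝ, 1 ≤ M → ∀ F : ℂ → ℂ, DifferentiableOn ℂ F (ball c R) →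
      (∀ z ∈ ball c R, (F z).re ≤ M) → (∀ z ∈ ball c r, (F z).re ≤ B) → ‖F c‖ ≤ B →
      ‖F q‖ ≤ A * M ^ t := by
  obtain ⟨S, hqS, hSR⟩ := exists_between (mem_ball.mp hq)
  obtain ⟨s, hs, hsr⟩ := exists_between hr
  have hsq : s < dist q c := hsr.trans_le hrq
  have hS : 0 < S := (hs.trans hsq).trans hqS
  have hrR : r < R := hrq.trans_lt hq
  have : 0 < R - S := sub_pos.mpr hSR
  have : 0 < r - s := sub_pos.mpr hsr
  set t := (Real.log (dist q c) - Real.log s) / (Real.log S - Real.log s)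
  have ht : t < 1 := by
    rw [div_lt_one (sub_pos.mpr (Real.log_lt_log hs (hsq.trans hqS)))]
    exact sub_lt_sub_right (Real.log_lt_log (hs.trans hsq) hqS) _
  refine ⟨(2 * (B + 1) * s / (r - s) + B * (r + s) / (r - s)) ^ (1 - t) *
    (2 * S / (R - S) + B * (R + S) / (R - S)) ^ t, t, ht, fun M hM F hF hFM hFB hFc => ?_⟩
  have hB : 0 ≤ B := (norm_nonneg _).trans hFc
  have hR : 0 < R := hS.trans hSR
  have hsmall : ∀ z ∈ sphere c s,
      ‖F z‖ ≤ 2 * (B + 1) * s / (r - s) + B * (r + s) / (r - s) := fun z hz => by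
    refine (norm_le_of_re_le_of_mem_sphere (M := B + 1) (by positivity)
      (hF.mono (ball_subset_ball hrR.le)) (fun w hw => ?_) hsr hz).trans (by gcongr)
    exact (hFB w hw).trans (lt_add_one B).le
  have hlarge : ∀ z ∈ sphere c S,
      ‖F z‖ ≤ (2 * S / (R - S) + B * (R + S) / (R - S)) * M := fun z hz =>
    calc ‖F z‖ ≤ 2 * M * S / (R - S) + ‖F c‖ * (R + S) / (R - S) :=
          norm_le_of_re_le_of_mem_sphere (by positivity) hF hFM hSR hz
      _ ≤ 2 * M * S / (R - S) + B * M * (R + S) / (R - S) := by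
          gcongr
          exact hFc.trans (le_mul_of_one_le_right hB hM)
      _ = (2 * S / (R - S) + B * (R + S) / (R - S)) * M := by ring
  have hinterp := norm_le_interp_of_mem_annulus hs (hsq.trans hqS)
    (hF.mono (Set.sdiff_subset.trans (closedBall_subset_ball hSR))) ⟨hqS.le, not_lt.mpr hsq.le⟩
    hsmall hlarge
  rwa [Real.mul_rpow (by positivity) (by positivity), ← mul_assoc] at hinterp

theorem exists_forall_harmonic_le_mul_rpow {c q : ℂ} {r R B : ℝ} (hr : 0 < r)
    (hq : q ∈ ball c R) :
    ∃ A t : ℝ, t < 1 ∧ ∀ M : ℝ, 1 ≤ M → ∀ u : ℂ → ℝ,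
      InnerProductSpace.HarmonicOnNhd u (ball c R) → (∀ z ∈ ball c R, u z ≤ M) →
      (∀ z ∈ ball c r, u z ≤ B) → |u c| ≤ B → u q ≤ A * M ^ t := by
  by_cases hqr : q ∈ ball c r
  · exact ⟨B, 0, one_pos, fun M _ u _ _ huB _ => by simpa using huB q hqr⟩
  have hrq : r ≤ dist q c := not_lt.mp hqr
  have hrR : r < R := hrq.trans_lt hq
  obtain ⟨A, t, ht, hAt⟩ := exists_forall_norm_le_mul_rpow (B := B) hr hrq hq
  refine ⟨A, t, ht, fun M hM u hu huM huB huc => ?_⟩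
  obtain ⟨F, hF, hFu, hFim⟩ := exists_analyticOnNhd_re_eq_of_harmonicOnNhd hu
  have hFc : ‖F c‖ = |u c| := by
    rw [← hFu c (mem_ball_self (hr.trans hrR)), ← Complex.abs_re_eq_norm.mpr hFim]
  rw [← hFu q hq]
  exact (Complex.re_le_norm _).trans <| hAt M hM F hF.differentiableOn
    (fun z hz => (hFu z hz).trans_le (huM z hz))
    (fun z hz => (hFu z (ball_subset_ball hrR.le hz)).trans_le (huB z hz)) (hFc.trans_le huc)

theorem eventually_const_mul_rpow_le_mul {t ε : ℝ} (A : ℝ) (ht : t < 1) (hε : 0 < ε) :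
    ∀ᶠ x : ℝ in atTop, A * x ^ t ≤ ε * x := by
  have hlim : Tendsto (fun x : ℝ => A * x ^ (-(1 - t))) atTop (𝓝 0) := by
    simpa using (tendsto_rpow_neg_atTop (sub_pos.mpr ht)).const_mul A
  filter_upwards [hlim.eventually (gt_mem_nhds hε), eventually_gt_atTop 0] with x hx hx₀
  calc A * x ^ t = A * x ^ (-(1 - t)) * x := by
        rw [mul_assoc, ← Real.rpow_add_one hx₀.ne', neg_sub, sub_add_cancel]
    _ ≤ ε * x := by gcongr

theorem eventually_norm_le_pow_of_forall_ne_zero {c q : ℂ} {r R K a C s : ℝ} (hr : 0 < r)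
    (hq : q ∈ ball c R) (ha : 0 < a) (hs : 1 < s) :
    ∀ᶠ n : ℕ in atTop, ∀ g : ℂ → ℂ, AnalyticOnNhd ℂ g (ball c R) →
      (∀ z ∈ ball c R, g z ≠ 0) → (∀ z ∈ ball c R, ‖g z‖ ≤ K ^ n) →
      (∀ z ∈ ball c r, ‖g z‖ ≤ C) → a ≤ ‖g c‖ → ‖g q‖ ≤ s ^ n := by
  have hlogs : 0 < Real.log s := Real.log_pos hs
  set κ := max 1 (Real.log K)
  have hκ : 0 < κ := one_pos.trans_le (le_max_left _ _)
  obtain ⟨A, t, ht, hAt⟩ :=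
    exists_forall_harmonic_le_mul_rpow (B := max |Real.log a| |Real.log (max 1 C)|) hr hq
  have hgrowth : Tendsto (fun n : ℕ => (n : ℝ) * κ) atTop atTop :=
    tendsto_natCast_atTop_atTop.atTop_mul_const hκ
  filter_upwards [hgrowth.eventually (eventually_const_mul_rpow_le_mul A ht (div_pos hlogs hκ)),
    hgrowth.eventually_ge_atTop 1] with n hn hn₁ g hg hg₀ hgK hgC hga
  have hu : InnerProductSpace.HarmonicOnNhd (fun z => Real.log ‖g z‖) (ball c R) :=
    fun z hz => (hg z hz).harmonicAt_log_norm (hg₀ z hz)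
  have huM : ∀ z ∈ ball c R, Real.log ‖g z‖ ≤ n * κ := fun z hz =>
    calc Real.log ‖g z‖ ≤ Real.log (K ^ n) :=
          Real.log_le_log (norm_pos_iff.mpr (hg₀ z hz)) (hgK z hz)
      _ = n * Real.log K := Real.log_pow ..
      _ ≤ n * κ := by gcongr; exact le_max_right _ _
  have huC : ∀ z ∈ ball c r, Real.log ‖g z‖ ≤ Real.log (max 1 C) := fun z hz => by
    rcases eq_or_ne (g z) 0 with hz₀ | hz₀
    · simpa only [hz₀, norm_zero, Real.log_zero] using Real.log_nonneg (le_max_left 1 C)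
    · exact Real.log_le_log (norm_pos_iff.mpr hz₀) ((hgC z hz).trans (le_max_right _ _))
  have huc : |Real.log ‖g c‖| ≤ max |Real.log a| |Real.log (max 1 C)| :=
    abs_le_max_abs_abs (Real.log_le_log ha hga) (huC c (mem_ball_self hr))
  have huq : Real.log ‖g q‖ ≤ Real.log (s ^ n) :=
    calc Real.log ‖g q‖ ≤ A * (n * κ) ^ t := hAt _ hn₁ _ hu huM
          (fun z hz => (huC z hz).trans ((le_abs_self _).trans (le_max_right _ _))) huc
      _ ≤ Real.log s / κ * (n * κ) := hn
      _ = Real.log (s ^ n) := by rw [Real.log_pow]; field_simp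
  exact (Real.log_le_log_iff (norm_pos_iff.mpr (hg₀ q hq)) (by positivity)).mp huq

section Convergence

theorem eventually_nhdsNE_ne_zero {D : Set ℂ} {f : ℂ → ℂ} {z₀ : ℂ} (hD : IsPreconnected D)
    (hf : AnalyticOnNhd ℂ f D) (hf₀ : ∃ z ∈ D, f z ≠ 0) (hz₀ : z₀ ∈ D) :
    ∀ᶠ z in 𝓝[≠] z₀, f z ≠ 0 := by
  refine (hf z₀ hz₀).eventually_eq_zero_or_eventually_ne_zero.resolve_left fun h => ?_
  obtain ⟨w, hw, hw₀⟩ := hf₀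
  exact hw₀ (hf.eqOn_zero_of_preconnected_of_eventuallyEq_zero hD hz₀ h hw)

theorem exists_mem_closedBall_eq_zero {g : ℂ → ℂ} {z₀ : ℂ} {ρ δ : ℝ} (hρ : 0 < ρ)
    (hg : DifferentiableOn ℂ g (closedBall z₀ ρ)) (hδ : ∀ z ∈ sphere z₀ ρ, δ ≤ ‖g z‖)
    (hz₀ : ‖g z₀‖ < δ) : ∃ z ∈ closedBall z₀ ρ, g z = 0 := by
  by_contra! hne
  have hδ₀ : 0 < δ := (norm_nonneg _).trans_lt hz₀
  have hinv : DiffContOnCl ℂ (fun z => (g z)⁻¹) (ball z₀ ρ) :=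
    (hg.inv hne).diffContOnCl_ball subset_rfl
  have hmax : ‖(g z₀)⁻¹‖ ≤ δ⁻¹ := by
    refine Complex.norm_le_of_forall_mem_frontier_norm_le isBounded_ball hinv (fun z hz => ?_)
      (subset_closure (mem_ball_self hρ))
    rw [frontier_ball z₀ hρ.ne'] at hz
    rw [norm_inv]
    exact inv_anti₀ hδ₀ (hδ z hz)
  rw [norm_inv, inv_le_inv₀ (norm_pos_iff.mpr (hne z₀ (mem_closedBall_self hρ.le))) hδ₀] at hmax
  exact hmax.not_gt hz₀

theorem eventually_exists_zero_of_tendstoLocallyUniformlyOn {ι : Type*} {L : Filter ι}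
    {g : ι → ℂ → ℂ} {f : ℂ → ℂ} {z₀ : ℂ} {U : Set ℂ} (hU : U ∈ 𝓝 z₀)
    (hg : ∀ᶠ n in L, DifferentiableOn ℂ (g n) U) (hf : ∀ᶠ z in 𝓝[≠] z₀, f z ≠ 0)
    (hf₀ : f z₀ = 0) (hgf : TendstoLocallyUniformlyOn g f L U) :
    ∀ᶠ n in L, ∃ z ∈ U, g n z = 0 := by
  rcases L.eq_or_neBot with rfl | hL
  · exact eventually_bot
  obtain ⟨ρ, hρ, hball⟩ := nhds_basis_closedBall.mem_iff.mp
    (inter_mem hU (eventually_nhdsWithin_iff.mp hf))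
  have hBU : closedBall z₀ ρ ⊆ U := fun z hz => (hball hz).1
  have hcont : ContinuousOn f (sphere z₀ ρ) :=
    (hgf.continuousOn (hg.mono fun n hn => hn.continuousOn).frequently).mono
      (sphere_subset_closedBall.trans hBU)
  obtain ⟨w, hw, hmin⟩ := (isCompact_sphere z₀ ρ).exists_isMinOn
    (NormedSpace.sphere_nonempty.mpr hρ.le) hcont.norm
  have hδ : 0 < ‖f w‖ := norm_pos_iff.mpr
    ((hball (sphere_subset_closedBall hw)).2 (ne_of_mem_sphere hw hρ.ne'))
  have hunif : TendstoUniformlyOn g f L (closedBall z₀ ρ) :=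
    (tendstoLocallyUniformlyOn_iff_tendstoUniformlyOn_of_compact (isCompact_closedBall z₀ ρ)).mp
      (hgf.mono hBU)
  filter_upwards [hg, tendstoUniformlyOn_iff.mp hunif _ (half_pos hδ)] with n hgn hn
  have hsphere : ∀ z ∈ sphere z₀ ρ, ‖f w‖ / 2 ≤ ‖g n z‖ := fun z hz => by
    have hfz : ‖f w‖ ≤ ‖f z‖ := hmin hz
    have hdist := hn z (sphere_subset_closedBall hz)
    rw [dist_eq_norm] at hdist
    linarith [norm_sub_norm_le (f z) (g n z)]
  have hcentre : ‖g n z₀‖ < ‖f w‖ / 2 := by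
    simpa only [hf₀, dist_zero_left] using hn z₀ (mem_closedBall_self hρ.le)
  obtain ⟨z, hz, hgz⟩ := exists_mem_closedBall_eq_zero hρ (hgn.mono hBU) hsphere hcentre
  exact ⟨z, hBU hz, hgz⟩

theorem tendsto_pow_atTop_prod_nhds_zero {X R : Type*} [SeminormedRing R] {u : X → R}
    {l : Filter X} {a : R} (hu : Tendsto u l (𝓝 a)) (ha : ‖a‖ < 1) :
    Tendsto (fun x : ℕ × X => u x.2 ^ x.1) (atTop ×ˢ l) (𝓝 0) := by
  obtain ⟨r, har, hr⟩ := exists_between ha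
  have hr_pow : Tendsto (fun n : ℕ => r ^ n) atTop (𝓝 0) :=
    tendsto_pow_atTop_nhds_zero_of_lt_one ((norm_nonneg a).trans har.le) hr
  refine squeeze_zero_norm' ?_ (hr_pow.comp tendsto_fst)
  filter_upwards [(eventually_gt_atTop 0).prod_mk (hu.norm.eventually (gt_mem_nhds har))]
    with x hx
  exact (norm_pow_le' _ hx.1).trans (pow_le_pow_left₀ (norm_nonneg _) hx.2.le _)

end Convergence

section Dominance

variable {m : ℕ} {D W : Set ℂ} {α β : Fin m → ℂ → ℂ} {k k' : Fin m} {z z₀ : ℂ}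

/-- The index `k` is the only dominant one at `z`, and `β_k(z) ≠ 0`; the second condition is
automatic if there are at least two indices. -/
structure IsStrictlyDominant (β : Fin m → ℂ → ℂ) (k : Fin m) (z : ℂ) : Prop where
  ne_zero : β k z ≠ 0
  norm_lt : ∀ l, l ≠ k → ‖β l z‖ < ‖β k z‖

theorem IsStrictlyDominant.isDominant (h : IsStrictlyDominant β k z) : IsDominant β k z :=
  fun l => (eq_or_ne l k).elim (fun hl => hl ▸ le_rfl) fun hl => (h.norm_lt l hl).le

theorem IsStrictlyDominant.eq_of_isDominant {l : Fin m} (h : IsStrictlyDominant β k z)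
    (hl : IsDominant β l z) : l = k :=
  not_not.mp fun hlk => (h.norm_lt l hlk).not_ge (hl k)

theorem IsDominant.isStrictlyDominant [Nontrivial (Fin m)] (hk : IsDominant β k z)
    (huniq : ∀ l, IsDominant β l z → l = k) : IsStrictlyDominant β k z := by
  have hlt : ∀ l, l ≠ k → ‖β l z‖ < ‖β k z‖ := fun l hl =>
    lt_of_not_ge fun hle => hl (huniq l fun j => (hk j).trans hle)
  obtain ⟨l, hl⟩ := exists_ne k
  exact ⟨norm_pos_iff.mp ((norm_nonneg _).trans_lt (hlt l hl)), hlt⟩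

theorem IsStrictlyDominant.eventually (hβ : ∀ l, ContinuousAt (β l) z₀)
    (h : IsStrictlyDominant β k z₀) : ∀ᶠ z in 𝓝 z₀, IsStrictlyDominant β k z := by
  have hlt : ∀ᶠ z in 𝓝 z₀, ∀ l, l ≠ k → ‖β l z‖ < ‖β k z‖ :=
    eventually_all.mpr fun l => eventually_imp_distrib_left.mpr fun hl =>
      (hβ l).norm.eventually_lt (hβ k).norm (h.norm_lt l hl)
  filter_upwards [(hβ k).eventually_ne h.ne_zero, hlt] with z hz₀ hz using ⟨hz₀, hz⟩

theorem exists_isDominant [Nonempty (Fin m)] (β : Fin m → ℂ → ℂ) (z : ℂ) :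
    ∃ k, IsDominant β k z :=
  Finite.exists_max fun k => ‖β k z‖

theorem exists_isStrictlyDominant_or_exists_ne [Nontrivial (Fin m)] (β : Fin m → ℂ → ℂ)
    (z : ℂ) : (∃ k, IsStrictlyDominant β k z) ∨
      ∃ k l, k ≠ l ∧ IsDominant β k z ∧ IsDominant β l z := by
  obtain ⟨k, hk⟩ := exists_isDominant β z
  by_cases huniq : ∀ l, IsDominant β l z → l = k
  · exact .inl ⟨k, hk.isStrictlyDominant huniq⟩
  · push Not at huniq
    obtain ⟨l, hl, hlk⟩ := huniq
    exact .inr ⟨l, k, hlk, hl, hk⟩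

theorem eventually_isDominant_imp (hβ : ∀ l, ContinuousAt (β l) z₀) :
    ∀ᶠ z in 𝓝 z₀, ∀ l, IsDominant β l z → IsDominant β l z₀ := by
  refine eventually_all.mpr fun l => ?_
  by_cases hl : IsDominant β l z₀
  · exact Eventually.of_forall fun _ _ => hl
  · simp only [IsDominant, not_forall, not_le] at hl
    obtain ⟨j, hj⟩ := hl
    filter_upwards [(hβ l).norm.eventually_lt (hβ j).norm hj] with z hz h
    exact absurd (h j) (not_le.mpr hz)

theorem eventually_ne_zero_of_isDominant (hβ : ∀ l, ContinuousAt (β l) z₀) (hk : β k z₀ ≠ 0) :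
    ∀ᶠ z in 𝓝 z₀, ∀ l, IsDominant β l z₀ → β l z ≠ 0 :=
  eventually_all.mpr fun l => eventually_imp_distrib_left.mpr fun hl =>
    (hβ l).eventually_ne (norm_pos_iff.mp ((norm_pos_iff.mpr hk).trans_le (hl k)))

theorem isOpen_inter_norm_lt {X E F : Type*} [TopologicalSpace X] [SeminormedAddGroup E]
    [SeminormedAddGroup F] {f : X → E} {g : X → F} {W : Set X} (hW : IsOpen W)
    (hf : ContinuousOn f W) (hg : ContinuousOn g W) : IsOpen (W ∩ {x | ‖f x‖ < ‖g x‖}) := by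
  have hsub : ContinuousOn (fun x => ‖g x‖ - ‖f x‖) W := hg.norm.sub hf.norm
  simpa only [Set.preimage, Set.mem_Ioi, sub_pos] using
    hsub.isOpen_inter_preimage hW (isOpen_Ioi (a := 0))

theorem exists_eventually_isDominant [Nonempty (Fin m)] (hW : IsOpen W) (hne : W.Nonempty)
    (hβ : ∀ l, ContinuousOn (β l) W) : ∃ p ∈ W, ∃ k, ∀ᶠ z in 𝓝 p, IsDominant β k z := by
  let C : Fin m → Set ℂ := fun k => (⋃ l, W ∩ {z | ‖β k z‖ < ‖β l z‖})ᶜ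
  have hC : ∀ k, IsClosed (C k) := fun k =>
    (isOpen_iUnion fun l => isOpen_inter_norm_lt hW (hβ k) (hβ l)).isClosed_compl
  have hCW : ∀ {k z}, z ∈ C k → z ∈ W → IsDominant β k z := fun hz hzW l =>
    not_lt.mp fun hlt => hz (Set.mem_iUnion.mpr ⟨l, hzW, hlt⟩)
  have hcover : ⋃ k, C k = Set.univ := Set.eq_univ_of_forall fun z => by
    obtain ⟨k, hk⟩ := exists_isDominant β z
    refine Set.mem_iUnion.mpr ⟨k, fun hz => ?_⟩
    obtain ⟨l, -, hl⟩ := Set.mem_iUnion.mp hz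
    exact (hk l).not_gt hl
  obtain ⟨p, hpW, hp⟩ :=
    (dense_iUnion_interior_of_closed hC hcover).inter_open_nonempty W hW hne
  obtain ⟨k, hpk⟩ := Set.mem_iUnion.mp hp
  refine ⟨p, hpW, k, ?_⟩
  filter_upwards [hW.mem_nhds hpW, mem_interior_iff_mem_nhds.mp hpk] with z hzW hzC
  exact hCW hzC hzW

theorem NoDegenerateDominance.eq_of_eventually_isDominant {l : Fin m}
    (hdom : NoDegenerateDominance D β) (hDopen : IsOpen D) (hDconn : IsPreconnected D)
    (hβ : ∀ k, AnalyticOnNhd ℂ (β k) D) (hz₀ : z₀ ∈ D) (hk : ∀ᶠ z in 𝓝 z₀, IsDominant β k z)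
    (hl : IsDominant β l z₀) (h₀ : β k z₀ ≠ 0) : l = k := by
  by_contra hlk
  set ω := β l z₀ / β k z₀
  have hω : ‖ω‖ = 1 := by
    rw [norm_div, le_antisymm (hk.self_of_nhds l) (hl k), div_self (norm_ne_zero_iff.mpr h₀)]
  have hne : ∀ᶠ z in 𝓝 z₀, β k z ≠ 0 := (hβ k z₀ hz₀).continuousAt.eventually_ne h₀
  have hconst : ∀ᶠ z in 𝓝 z₀, β l z / β k z = ω := by
    refine Complex.eventually_eq_of_isLocalMax_norm (f := fun z => β l z / β k z) ?_ ?_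
    · filter_upwards [hne, hDopen.mem_nhds hz₀] with z hz hzD
      exact (hβ l z hzD).differentiableAt.div (hβ k z hzD).differentiableAt hz
    · filter_upwards [hk, hne] with z hz hz₀
      calc ‖β l z / β k z‖ ≤ 1 := by
            rw [norm_div, div_le_one (norm_pos_iff.mpr hz₀)]
            exact hz l
        _ = ‖ω‖ := hω.symm
  have heq : Set.EqOn (β l) (fun z => ω * β k z) D := by
    refine (hβ l).eqOn_of_preconnected_of_eventuallyEq (analyticOnNhd_const.mul (hβ k)) hDconn
      hz₀ ?_
    filter_upwards [hconst, hne] with z hz hz₀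
    rw [← hz, div_mul_cancel₀ _ hz₀]
  refine hdom ⟨l, k, hlk, ⟨ω, hω, heq⟩, z₀, mem_interior_iff_mem_nhds.mpr ?_⟩
  filter_upwards [hk, hDopen.mem_nhds hz₀] with z hz hzD
  refine ⟨hzD, fun j => (hz j).trans_eq ?_⟩
  rw [heq hzD, norm_mul, hω, one_mul]

theorem NoDegenerateDominance.exists_isStrictlyDominant [Nonempty (Fin m)]
    (hdom : NoDegenerateDominance D β) (hDopen : IsOpen D) (hDconn : IsPreconnected D)
    (hα : ∀ k, AnalyticOnNhd ℂ (α k) D) (hβ : ∀ k, AnalyticOnNhd ℂ (β k) D)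
    (hα₀ : ∀ k, ∃ z ∈ D, α k z ≠ 0) (hβ₀ : ∀ k, ∃ z ∈ D, β k z ≠ 0)
    (hW : IsOpen W) (hne : W.Nonempty) (hWD : W ⊆ D) :
    ∃ p ∈ W, ∃ k, IsStrictlyDominant β k p ∧ α k p ≠ 0 := by
  obtain ⟨w, hw, k, hk⟩ :=
    exists_eventually_isDominant hW hne fun l => (hβ l).continuousOn.mono hWD
  have hwW : ∀ᶠ z in 𝓝 w, z ∈ W ∧ ∀ᶠ z in 𝓝 z, IsDominant β k z :=
    (hW.eventually_mem hw).and hk.eventually_nhds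
  obtain ⟨p, ⟨hpW, hpk⟩, hαp, hβp⟩ := ((hwW.filter_mono nhdsWithin_le_nhds).and
    ((eventually_nhdsNE_ne_zero hDconn (hα k) (hα₀ k) (hWD hw)).and
      (eventually_nhdsNE_ne_zero hDconn (hβ k) (hβ₀ k) (hWD hw)))).exists
  refine ⟨p, hpW, k, ⟨hβp, fun l hlk => lt_of_not_ge fun hle => hlk ?_⟩, hαp⟩
  exact hdom.eq_of_eventually_isDominant hDopen hDconn hβ (hWD hpW) hpk
    (fun j => (hpk.self_of_nhds j).trans hle) hβp

theorem NoDegenerateDominance.exists_pair_isStrictlyDominant {i j : Fin m}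
    (hdom : NoDegenerateDominance D β) (hDopen : IsOpen D) (hDconn : IsPreconnected D)
    (hα : ∀ k, AnalyticOnNhd ℂ (α k) D) (hβ : ∀ k, AnalyticOnNhd ℂ (β k) D)
    (hα₀ : ∀ k, ∃ z ∈ D, α k z ≠ 0) (hβ₀ : ∀ k, ∃ z ∈ D, β k z ≠ 0)
    (hW : IsOpen W) (hWD : W ⊆ D) (hz₀ : z₀ ∈ W) (hij : i ≠ j) (hi : IsDominant β i z₀)
    (hj : IsDominant β j z₀) (hi₀ : β i z₀ ≠ 0) :
    ∃ p ∈ W, ∃ q ∈ W, ∃ k k', k ≠ k' ∧ (IsStrictlyDominant β k p ∧ α k p ≠ 0) ∧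
      IsStrictlyDominant β k' q ∧ α k' q ≠ 0 := by
  have : Nonempty (Fin m) := ⟨i⟩
  obtain ⟨p, hp, k, hkp⟩ :=
    hdom.exists_isStrictlyDominant hDopen hDconn hα hβ hα₀ hβ₀ hW ⟨z₀, hz₀⟩ hWD
  obtain ⟨w, hw, l, hl⟩ : ∃ w ∈ W, ∃ l, ‖β k w‖ < ‖β l w‖ := by
    by_contra! hk
    have hk_ev : ∀ᶠ z in 𝓝 z₀, IsDominant β k z := (hW.eventually_mem hz₀).mono hk
    have hk₀ : β k z₀ ≠ 0 := norm_pos_iff.mp ((norm_pos_iff.mpr hi₀).trans_le (hk z₀ hz₀ i))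
    have huniq : ∀ a, IsDominant β a z₀ → a = k := fun a ha =>
      hdom.eq_of_eventually_isDominant hDopen hDconn hβ (hWD hz₀) hk_ev ha hk₀
    exact hij ((huniq i hi).trans (huniq j hj).symm)
  have hcont : ∀ a, ContinuousOn (β a) W := fun a => (hβ a).continuousOn.mono hWD
  obtain ⟨q, ⟨hq, hql⟩, k', hk'q⟩ := hdom.exists_isStrictlyDominant hDopen hDconn hα hβ hα₀ hβ₀
    (isOpen_inter_norm_lt hW (hcont k) (hcont l)) ⟨w, hw, hl⟩ (Set.inter_subset_left.trans hWD)
  refine ⟨p, hp, q, hq, k, k', ?_, hkp, hk'q⟩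
  rintro rfl
  exact (hk'q.1.isDominant l).not_gt hql

end Dominance

section Zeros

variable {m : ℕ} {D S V : Set ℂ} {α β : Fin m → ℂ → ℂ} {k k' : Fin m} {p q z₀ : ℂ}

theorem liminfSets_subset_limsupSets (D : Set ℂ) (Z : ℕ → Set ℂ) :
    liminfSets D Z ⊆ limsupSets D Z :=
  fun _ hz => ⟨hz.1, fun U hU => (hz.2 U hU).frequently⟩

theorem fSeq_div_pow (α β : Fin m → ℂ → ℂ) (k : Fin m) (n : ℕ) (z : ℂ) :
    fSeq α β n z / β k z ^ n = ∑ l, α l z * (β l z / β k z) ^ n := by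
  simp only [fSeq, Finset.sum_div, div_pow, mul_div_assoc]

theorem analyticOnNhd_fSeq_div_pow (hα : ∀ l, AnalyticOnNhd ℂ (α l) S)
    (hβ : ∀ l, AnalyticOnNhd ℂ (β l) S) (hk : ∀ z ∈ S, β k z ≠ 0) (n : ℕ) :
    AnalyticOnNhd ℂ (fun z => fSeq α β n z / β k z ^ n) S := by
  simp only [fSeq_div_pow]
  exact Finset.univ.analyticOnNhd_fun_sum fun l _ =>
    (hα l).mul (((hβ l).div (hβ k) hk).pow n)

theorem tendsto_fSeq_div_pow (hα : ∀ l, ContinuousAt (α l) z₀)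
    (hβ : ∀ l, ContinuousAt (β l) z₀) (hk : IsStrictlyDominant β k z₀) :
    Tendsto (fun x : ℕ × ℂ => fSeq α β x.1 x.2 / β k x.2 ^ x.1) (atTop ×ˢ 𝓝 z₀)
      (𝓝 (α k z₀)) := by
  have hterm : ∀ l, Tendsto (fun x : ℕ × ℂ => α l x.2 * (β l x.2 / β k x.2) ^ x.1)
      (atTop ×ˢ 𝓝 z₀) (𝓝 (if l = k then α k z₀ else 0)) := fun l => by
    have hαl : Tendsto (fun x : ℕ × ℂ => α l x.2) (atTop ×ˢ 𝓝 z₀) (𝓝 (α l z₀)) :=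
      (hα l).tendsto.comp tendsto_snd
    split_ifs with hl
    · subst hl
      refine hαl.congr' ?_
      filter_upwards [((hβ l).eventually_ne hk.ne_zero).prod_inr _] with x hx
      rw [div_self hx, one_pow, mul_one]
    · have hquot : Tendsto (fun z => β l z / β k z) (𝓝 z₀) (𝓝 (β l z₀ / β k z₀)) :=
        (hβ l).tendsto.div (hβ k).tendsto hk.ne_zero
      have hlt : ‖β l z₀ / β k z₀‖ < 1 := by
        rw [norm_div, div_lt_one (norm_pos_iff.mpr hk.ne_zero)]
        exact hk.norm_lt l hl
      simpa only [mul_zero] using hαl.mul (tendsto_pow_atTop_prod_nhds_zero hquot hlt)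
  simpa only [fSeq_div_pow, Finset.sum_ite_eq', Finset.mem_univ, if_true] using
    tendsto_finsetSum Finset.univ fun l _ => hterm l

theorem tendstoLocallyUniformlyOn_fSeq_div_pow (hα : ∀ l, ∀ z ∈ V, ContinuousAt (α l) z)
    (hβ : ∀ l, ∀ z ∈ V, ContinuousAt (β l) z) (hk : ∀ z ∈ V, IsStrictlyDominant β k z) :
    TendstoLocallyUniformlyOn (fun n z => fSeq α β n z / β k z ^ n) (α k) atTop V := by
  refine tendstoLocallyUniformlyOn_iff_forall_tendsto.mpr fun z hz => ?_
  have hfst : Tendsto (fun x : ℕ × ℂ => α k x.2) (atTop ×ˢ 𝓝 z) (𝓝 (α k z)) :=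
    (hα k z hz).tendsto.comp tendsto_snd
  have hsnd := tendsto_fSeq_div_pow (fun l => hα l z hz) (fun l => hβ l z hz) (hk z hz)
  refine ((hfst.prodMk_nhds hsnd).mono_right ?_).mono_left
    (prod_mono_right atTop nhdsWithin_le_nhds)
  exact nhds_le_uniformity _

theorem notMem_limsupSets_of_isStrictlyDominant (hα : ∀ l, ContinuousAt (α l) z₀)
    (hβ : ∀ l, ContinuousAt (β l) z₀) (hk : IsStrictlyDominant β k z₀) (hαk : α k z₀ ≠ 0) :
    z₀ ∉ limsupSets D (fun n => zeroSet D (fSeq α β n)) := by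
  rintro ⟨-, hz₀⟩
  obtain ⟨P, hP, Q, hQ, hPQ⟩ :=
    eventually_prod_iff.mp ((tendsto_fSeq_div_pow hα hβ hk).eventually_ne hαk)
  obtain ⟨n, ⟨z, hzQ, -, hz⟩, hn⟩ := ((hz₀ _ hQ).and_eventually hP).exists
  exact (div_ne_zero_iff.mp (hPQ hn hzQ)).1 hz

theorem mem_liminfSets_of_isStrictlyDominant (hDopen : IsOpen D) (hDconn : IsPreconnected D)
    (hα : ∀ l, AnalyticOnNhd ℂ (α l) D) (hβ : ∀ l, AnalyticOnNhd ℂ (β l) D)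
    (hα₀ : ∃ z ∈ D, α k z ≠ 0) (hz₀ : z₀ ∈ D) (hk : IsStrictlyDominant β k z₀)
    (hαk : α k z₀ = 0) : z₀ ∈ liminfSets D (fun n => zeroSet D (fSeq α β n)) := by
  refine ⟨hz₀, fun U hU => ?_⟩
  set V := (U ∩ D) ∩ {z | IsStrictlyDominant β k z}
  have hV : V ∈ 𝓝 z₀ := inter_mem (inter_mem hU (hDopen.mem_nhds hz₀))
    (hk.eventually fun l => (hβ l z₀ hz₀).continuousAt)
  have hVD : V ⊆ D := fun z hz => hz.1.2
  have hlim := tendstoLocallyUniformlyOn_fSeq_div_pow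
    (fun l z hz => (hα l z (hVD hz)).continuousAt) (fun l z hz => (hβ l z (hVD hz)).continuousAt)
    fun z (hz : z ∈ V) => hz.2
  have hdiff (n : ℕ) : DifferentiableOn ℂ (fun z => fSeq α β n z / β k z ^ n) V :=
    (analyticOnNhd_fSeq_div_pow (fun l => (hα l).mono hVD) (fun l => (hβ l).mono hVD)
      (fun z hz => hz.2.ne_zero) n).differentiableOn
  filter_upwards [eventually_exists_zero_of_tendstoLocallyUniformlyOn hV
    (Eventually.of_forall hdiff) (eventually_nhdsNE_ne_zero hDconn (hα k) hα₀ hz₀) hαk hlim]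
    with n hn
  obtain ⟨z, hz, hzero⟩ := hn
  exact ⟨z, hz.1.1, hVD hz,
    (div_eq_zero_iff.mp hzero).resolve_right (pow_ne_zero n hz.2.ne_zero)⟩

theorem exists_norm_fSeq_div_pow_le (hS : IsCompact S) (hα : ∀ l, ContinuousOn (α l) S)
    (hβ : ∀ l, ContinuousOn (β l) S) (hk : ∀ z ∈ S, β k z ≠ 0) :
    ∃ K : ℝ, ∀ n : ℕ, n ≠ 0 → ∀ z ∈ S, ‖fSeq α β n z / β k z ^ n‖ ≤ K ^ n := by
  obtain ⟨A, hA⟩ := hS.bddAbove_image (f := fun z => ∑ l, ‖α l z‖)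
    (continuousOn_finsetSum _ fun l _ => (hα l).norm)
  obtain ⟨B, hB⟩ := hS.bddAbove_image (f := fun z => ∑ l, ‖β l z / β k z‖)
    (continuousOn_finsetSum _ fun l _ => ((hβ l).div (hβ k) hk).norm)
  refine ⟨max 1 A * B, fun n hn z hz => ?_⟩
  have hAz : ∑ l, ‖α l z‖ ≤ A := hA (Set.mem_image_of_mem _ hz)
  have hBz : ∀ l, ‖β l z / β k z‖ ≤ B := fun l =>
    (Finset.single_le_sum (f := fun l => ‖β l z / β k z‖) (fun _ _ => norm_nonneg _)
      (Finset.mem_univ l)).trans (hB (Set.mem_image_of_mem _ hz))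
  have hB₀ : 0 ≤ B := (norm_nonneg _).trans (hBz k)
  calc ‖fSeq α β n z / β k z ^ n‖ ≤ ∑ l, ‖α l z‖ * ‖β l z / β k z‖ ^ n := by
        simpa only [fSeq_div_pow, norm_mul, norm_pow] using
          norm_sum_le Finset.univ fun l => α l z * (β l z / β k z) ^ n
    _ ≤ ∑ l, ‖α l z‖ * B ^ n := by gcongr with l; exact hBz l
    _ = (∑ l, ‖α l z‖) * B ^ n := by rw [Finset.sum_mul]
    _ ≤ max 1 A ^ n * B ^ n := by
        gcongr
        exact hAz.trans ((le_max_right 1 A).trans (le_self_pow₀ (le_max_left 1 A) hn))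
    _ = (max 1 A * B) ^ n := (mul_pow _ _ _).symm

theorem eventually_pow_lt_norm_fSeq_div_pow {s : ℝ} (hα : ∀ l, ContinuousAt (α l) q)
    (hβ : ∀ l, ContinuousAt (β l) q) (hk' : IsStrictlyDominant β k' q) (hαk' : α k' q ≠ 0)
    (hs₀ : 0 ≤ s) (hk : β k q ≠ 0) (hs : s * ‖β k q‖ < ‖β k' q‖) :
    ∀ᶠ n : ℕ in atTop, s ^ n < ‖fSeq α β n q / β k q ^ n‖ := by
  have : 0 < ‖β k q‖ := norm_pos_iff.mpr hk
  have hk'₀ : 0 < ‖β k' q‖ := norm_pos_iff.mpr hk'.ne_zero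
  have hlim : Tendsto (fun n : ℕ => ‖fSeq α β n q / β k' q ^ n‖) atTop (𝓝 ‖α k' q‖) :=
    ((tendsto_fSeq_div_pow hα hβ hk').comp (tendsto_id.prodMk tendsto_const_nhds)).norm
  have hzero : Tendsto (fun n : ℕ => (s * ‖β k q‖ / ‖β k' q‖) ^ n) atTop (𝓝 0) :=
    tendsto_pow_atTop_nhds_zero_of_lt_one (by positivity) ((div_lt_one hk'₀).mpr hs)
  filter_upwards [hzero.eventually_lt hlim (norm_pos_iff.mpr hαk')] with n hn
  rw [norm_div, norm_pow, div_pow, mul_pow, div_lt_div_iff_of_pos_right (by positivity)] at hn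
  rwa [norm_div, norm_pow, lt_div_iff₀ (by positivity)]

theorem eventually_exists_zero_of_isStrictlyDominant {R : ℝ}
    (hα : ∀ l, AnalyticOnNhd ℂ (α l) (closedBall p R))
    (hβ : ∀ l, AnalyticOnNhd ℂ (β l) (closedBall p R)) (hk₀ : ∀ z ∈ closedBall p R, β k z ≠ 0)
    (hq : q ∈ ball p R) (hkk' : k ≠ k') (hk : IsStrictlyDominant β k p) (hαk : α k p ≠ 0)
    (hk' : IsStrictlyDominant β k' q) (hαk' : α k' q ≠ 0) :
    ∀ᶠ n in atTop, ∃ z ∈ ball p R, fSeq α β n z = 0 := by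
  have hBS : ball p R ⊆ closedBall p R := ball_subset_closedBall
  have hpR : p ∈ closedBall p R := mem_closedBall_self (dist_nonneg.trans hq.le)
  obtain ⟨K, hK⟩ := exists_norm_fSeq_div_pow_le (isCompact_closedBall p R)
    (fun l => (hα l).continuousOn) (fun l => (hβ l).continuousOn) hk₀
  have hαp : 0 < ‖α k p‖ := norm_pos_iff.mpr hαk
  have hlim := (tendsto_fSeq_div_pow (fun l => (hα l p hpR).continuousAt)
    (fun l => (hβ l p hpR).continuousAt) hk).norm
  obtain ⟨P, hP, Q, hQ, hPQ⟩ := eventually_prod_iff.mp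
    (hlim.eventually (Ioo_mem_nhds (half_lt_self hαp) (lt_add_one _)))
  obtain ⟨r, hr, hrQ⟩ := nhds_basis_ball.mem_iff.mp hQ
  have hβq : 0 < ‖β k q‖ := norm_pos_iff.mpr (hk₀ q (hBS hq))
  obtain ⟨s, hs₁, hs⟩ := exists_between ((one_lt_div hβq).mpr (hk'.norm_lt k hkk'))
  filter_upwards [hP, eventually_ne_atTop 0,
    eventually_norm_le_pow_of_forall_ne_zero (K := K) (C := ‖α k p‖ + 1) hr hq (half_pos hαp) hs₁,
    eventually_pow_lt_norm_fSeq_div_pow (fun l => (hα l q (hBS hq)).continuousAt)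
      (fun l => (hβ l q (hBS hq)).continuousAt) hk' hαk' (one_pos.trans hs₁).le
      (norm_pos_iff.mp hβq) ((lt_div_iff₀ hβq).mp hs)] with n hn hn₀ hupper hlower
  by_contra! hne
  refine hlower.not_ge (hupper (fun z => fSeq α β n z / β k z ^ n) ?_ (fun z hz => ?_)
    (fun z hz => ?_) (fun z hz => ?_) ?_)
  · exact (analyticOnNhd_fSeq_div_pow hα hβ hk₀ n).mono hBS
  · exact div_ne_zero (hne z hz) (pow_ne_zero n (hk₀ z (hBS hz)))
  · exact hK n hn₀ z (hBS hz)
  · exact (hPQ hn (hrQ hz)).2.le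
  · exact (hPQ hn (hrQ (mem_ball_self hr))).1.le

theorem mem_liminfSets_of_two_dominant {i j : Fin m} (hdom : NoDegenerateDominance D β)
    (hDopen : IsOpen D) (hDconn : IsPreconnected D) (hα : ∀ k, AnalyticOnNhd ℂ (α k) D)
    (hβ : ∀ k, AnalyticOnNhd ℂ (β k) D) (hα₀ : ∀ k, ∃ z ∈ D, α k z ≠ 0)
    (hβ₀ : ∀ k, ∃ z ∈ D, β k z ≠ 0) (hz₀ : z₀ ∈ D) (hij : i ≠ j) (hi : IsDominant β i z₀)
    (hj : IsDominant β j z₀) : z₀ ∈ liminfSets D (fun n => zeroSet D (fSeq α β n)) := by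
  refine ⟨hz₀, fun U hU => ?_⟩
  by_cases hi₀ : β i z₀ = 0
  · have hβz₀ : ∀ l, β l z₀ = 0 := fun l => norm_le_zero_iff.mp (by simpa [hi₀] using hi l)
    filter_upwards [eventually_ne_atTop 0] with n hn
    refine ⟨z₀, mem_of_mem_nhds hU, hz₀, Finset.sum_eq_zero fun l _ => ?_⟩
    rw [hβz₀ l, zero_pow hn, mul_zero]
  have hcont : ∀ l, ContinuousAt (β l) z₀ := fun l => (hβ l z₀ hz₀).continuousAt
  obtain ⟨ρ, hρ, hball⟩ := nhds_basis_ball.mem_iff.mp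
    (inter_mem (inter_mem hU (hDopen.mem_nhds hz₀))
      ((eventually_isDominant_imp hcont).and (eventually_ne_zero_of_isDominant hcont hi₀)))
  have hsmall : ball z₀ (ρ / 4) ⊆ ball z₀ ρ := ball_subset_ball (by linarith)
  obtain ⟨p, hp, q, hq, k, k', hkk', ⟨hk, hαk⟩, hk', hαk'⟩ :=
    hdom.exists_pair_isStrictlyDominant hDopen hDconn hα hβ hα₀ hβ₀ isOpen_ball
      (fun z hz => (hball (hsmall hz)).1.2) (mem_ball_self (by positivity)) hij hi hj hi₀
  have hpρ : closedBall p (ρ / 2) ⊆ ball z₀ ρ :=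
    closedBall_subset_ball' (by linarith [mem_ball.mp hp])
  have hpD : closedBall p (ρ / 2) ⊆ D := fun z hz => (hball (hpρ hz)).1.2
  have hkz₀ : IsDominant β k z₀ := (hball (hsmall hp)).2.1 k hk.isDominant
  have hqp : q ∈ ball p (ρ / 2) := mem_ball.mpr
    (by linarith [dist_triangle_right q p z₀, mem_ball.mp hp, mem_ball.mp hq])
  filter_upwards [eventually_exists_zero_of_isStrictlyDominant (fun l => (hα l).mono hpD)
    (fun l => (hβ l).mono hpD) (fun z hz => (hball (hpρ hz)).2.2 k hkz₀) hqp hkk' hk hαk hk' hαk']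
    with n hn
  obtain ⟨z, hz, hzero⟩ := hn
  have hz' : z ∈ closedBall p (ρ / 2) := ball_subset_closedBall hz
  exact ⟨z, (hball (hpρ hz')).1.1, hpD hz', hzero⟩

end Zeros

end BKW

theorem theorem1p5 (D : Set ℂ) (hDopen : IsOpen D) (hDconn : IsConnected D)
    (m : ℕ) (hm : 2 ≤ m) (α β : Fin m → ℂ → ℂ)
    (hα : ∀ k, AnalyticOnNhd ℂ (α k) D) (hβ : ∀ k, AnalyticOnNhd ℂ (β k) D)
    (hα0 : ∀ k, ∃ z ∈ D, α k z ≠ 0) (hβ0 : ∀ k, ∃ z ∈ D, β k z ≠ 0)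
    (hdom : BKW.NoDegenerateDominance D β) :
    BKW.liminfSets D (fun n => BKW.zeroSet D (BKW.fSeq α β n)) =
        BKW.limsupSets D (fun n => BKW.zeroSet D (BKW.fSeq α β n)) ∧
      ∀ z ∈ D, z ∈ BKW.liminfSets D (fun n => BKW.zeroSet D (BKW.fSeq α β n)) ↔
        (∃ k, BKW.IsDominant β k z ∧ (∀ l, BKW.IsDominant β l z → l = k) ∧ α k z = 0) ∨
        (∃ k l, k ≠ l ∧ BKW.IsDominant β k z ∧ BKW.IsDominant β l z) := by
  have : Nontrivial (Fin m) := Fin.nontrivial_iff_two_le.mpr hm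
  have hsub := BKW.liminfSets_subset_limsupSets D fun n => BKW.zeroSet D (BKW.fSeq α β n)
  have hsuff : ∀ z ∈ D, ((∃ k, BKW.IsDominant β k z ∧ (∀ l, BKW.IsDominant β l z → l = k) ∧
      α k z = 0) ∨ (∃ k l, k ≠ l ∧ BKW.IsDominant β k z ∧ BKW.IsDominant β l z)) →
      z ∈ BKW.liminfSets D (fun n => BKW.zeroSet D (BKW.fSeq α β n)) := by
    rintro z hz (⟨k, hk, huniq, hαk⟩ | ⟨k, l, hkl, hk, hl⟩)
    · exact BKW.mem_liminfSets_of_isStrictlyDominant hDopen hDconn.isPreconnected hα hβ (hα0 k) hz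
        (hk.isStrictlyDominant huniq) hαk
    · exact BKW.mem_liminfSets_of_two_dominant hdom hDopen hDconn.isPreconnected hα hβ hα0 hβ0 hz
        hkl hk hl
  have hnec : ∀ z ∈ BKW.limsupSets D (fun n => BKW.zeroSet D (BKW.fSeq α β n)),
      (∃ k, BKW.IsDominant β k z ∧ (∀ l, BKW.IsDominant β l z → l = k) ∧ α k z = 0) ∨
      (∃ k l, k ≠ l ∧ BKW.IsDominant β k z ∧ BKW.IsDominant β l z) := fun z hz =>
    (BKW.exists_isStrictlyDominant_or_exists_ne β z).imp_left fun ⟨k, hk⟩ =>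
      ⟨k, hk.isDominant, fun _ hl => hk.eq_of_isDominant hl, not_not.mp fun hαk =>
        BKW.notMem_limsupSets_of_isStrictlyDominant (fun l => (hα l z hz.1).continuousAt)
          (fun l => (hβ l z hz.1).continuousAt) hk hαk hz⟩
  exact ⟨hsub.antisymm fun z hz => hsuff z hz.1 (hnec z hz),
    fun z hz => ⟨fun h => hnec z (hsub h), hsuff z hz⟩⟩
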